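/- Let $-\infty<a<b<\infty$, $\varepsilon_0>0$, and write $L_1=L_1((a,b),\mathbb C)$, $L_2=L_2((a,b),\mathbb C)$. For every $\varepsilon\in[0,\varepsilon_0]$ let $p_\varepsilon,Q_\varepsilon:(a,b)\to\mathbb C$ be measurable functions with $p_\varepsilon\neq 0$ almost everywhere and $$\frac1{p_\varepsilon},\quad \frac{Q_\varepsilon}{p_\varepsilon},\quad \frac{Q_\varepsilon^2}{p_\varepsilon}\in L_1,$$ and let $\alpha(\varepsilon),\beta(\varepsilon)\in\mathbb C^{2\times2}$. Define the quasi-derivatives $$D^{[1]}_\varepsilon y=p_\varepsilon y'-Q_\varepsilon y,\qquad D^{[2]}_\varepsilon y=(D^{[1]}_\varepsilon y)'+\frac{Q_\varepsilon}{p_\varepsilon}D^{[1]}_\varepsilon y+\frac{Q_\varepsilon^2}{p_\varepsilon}y,$$ which regularize the formal expression $-(p_\varepsilon y')'+Q_\varepsilon'y$ as $-D^{[2]}_\varepsilon y$. Let $L_\varepsilon$ be the operator in $L_2$ given by $L_\varepsilon y=-D^{[2]}_\varepsilon y$ on the domain of all $y\in L_2$ such that $y$ and $D^{[1]}_\varepsilon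 y$ are absolutely continuous on $[a,b]$, $D^{[2]}_\varepsilon y\in L_2$, and $$\alpha(\varepsilon)\begin{pmatrix}y(a)\\ (D^{[1]}_\varepsilon y)(a)\end{pmatrix}+\beta(\varepsilon)\begin{pmatrix}y(b)\\ (D^{[1]}_\varepsilon y)(b)\end{pmatrix}=0.$$ The resolvent set $\rho(L)$ of an operator $L$ in $L_2$ is the set of all $\mu\in\mathbb C$ such that $L-\mu$ has a bounded, everywhere defined inverse $(L-\mu)^{-1}$ on $L_2$. Suppose that $\rho(L_0)$ is not empty and that, as $\varepsilon\to0+$, 1. $\|1/p_\varepsilon-1/p_0\|_{L_1}\to0$, 2. $\|Q_\varepsilon/p_\varepsilon-Q_0/p_0\|_{L_1}\to0$, 3. $\|Q_\varepsilon^2/p_\varepsilon-Q_0^2/p_0\|_{L_1}\to0$, 4. $\alpha(\varepsilon)\to\alpha(0)$ and $\beta(\varepsilon)\to\beta(0)$. Then $L_\varepsilon$ converges to $L_0$ in the norm resolvent sense as $\varepsilon\to0+$; that is, there is $\mu\in\rho(L_0)$ such that $\mu\in\rho(L_\varepsilon)$ for all sufficiently small $\varepsilon>0$ and $$\|(L_\varepsilon-\mu)^{-1}-(L_0-\mu)^{-1}\|\to0\qquad(\varepsilon\to0+).$$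 -/

import Mathlib

open MeasureTheory Filter Topology Set

noncomputable section

namespace SturmLiouville

/-- The Hilbert space `L₂((a, b), ℂ)`. -/
abbrev L2 (a b : ℝ) : Type := Lp ℂ 2 (volume.restrict (Ioo a b))

/-- The standing assumptions on the coefficients on `(a, b)`: `p ≠ 0` almost everywhere (so that
`1 / p` is meaningful) and `1 / p`, `Q / p`, `Q ^ 2 / p` belong to `L₁((a, b), ℂ)`. -/
structure Admissible (a b : ℝ) (p Q : ℝ → ℂ) : Prop where
  ne_zero : ∀ᵐ t ∂volume.restrict (Ioo a b), p t ≠ 0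
  inv_integrable : IntegrableOn (fun t => 1 / p t) (Ioo a b)
  div_integrable : IntegrableOn (fun t => Q t / p t) (Ioo a b)
  sq_div_integrable : IntegrableOn (fun t => Q t ^ 2 / p t) (Ioo a b)

/-- The first quasi-derivative `D^[1] y = p y' - Q y` (a function defined almost everywhere). -/
def quasiDeriv (p Q y : ℝ → ℂ) (t : ℝ) : ℂ := p t * deriv y t - Q t * y t

/-- The second quasi-derivative `D^[2] y = (D^[1] y)' + (Q / p) D^[1] y + (Q ^ 2 / p) y`, where
`v` is the absolutely continuous representative of `D^[1] y`. -/
def quasiDeriv2 (p Q y v : ℝ → ℂ) (t : ℝ) : ℂ :=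
  deriv v t + Q t / p t * v t + Q t ^ 2 / p t * y t

/-- `IsMaxPair a b p Q y f u v`: the element `y` of `L₂` lies in the domain of the maximal operator
and `l[y] = -D^[2] y = f`, where `u` and `v` are the absolutely continuous representatives on
`[a, b]` of `y` and of `D^[1] y`. -/
structure IsMaxPair (a b : ℝ) (p Q : ℝ → ℂ) (y f : L2 a b) (u v : ℝ → ℂ) : Prop where
  ac_zero : AbsolutelyContinuousOnInterval u a b
  ac_one : AbsolutelyContinuousOnInterval v a b
  rep_zero : y =ᵐ[volume.restrict (Ioo a b)] u
  rep_one : v =ᵐ[volume.restrict (Ioo a b)] quasiDeriv p Q u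
  rep_two : f =ᵐ[volume.restrict (Ioo a b)] fun t => -quasiDeriv2 p Q u v t

/-- An absolutely continuous complex function is differentiable almost everywhere. -/
theorem ae_differentiableAt {a b : ℝ} {u : ℝ → ℂ} (hu : AbsolutelyContinuousOnInterval u a b) :
    ∀ᵐ t ∂volume.restrict (Ioo a b), DifferentiableAt ℝ u t := by
  rw [ae_restrict_iff' measurableSet_Ioo]
  filter_upwards [hu.boundedVariationOn.ae_differentiableAt_of_mem_uIcc] with t ht h
  exact ht (Icc_subset_uIcc (Ioo_subset_Icc_self h))

theorem IsMaxPair.add {a b : ℝ} {p Q : ℝ → ℂ} {y f y' f' : L2 a b} {u v u' v' : ℝ → ℂ}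
    (h : IsMaxPair a b p Q y f u v) (h' : IsMaxPair a b p Q y' f' u' v') :
    IsMaxPair a b p Q (y + y') (f + f') (u + u') (v + v') where
  ac_zero := h.ac_zero.add h'.ac_zero
  ac_one := h.ac_one.add h'.ac_one
  rep_zero := (Lp.coeFn_add y y').trans (h.rep_zero.add h'.rep_zero)
  rep_one := by
    filter_upwards [h.rep_one, h'.rep_one, ae_differentiableAt h.ac_zero,
      ae_differentiableAt h'.ac_zero] with t h1 h2 h3 h4
    simp only [Pi.add_apply, h1, h2, quasiDeriv, deriv_add h3 h4]
    ring
  rep_two := by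
    filter_upwards [Lp.coeFn_add f f', h.rep_two, h'.rep_two, ae_differentiableAt h.ac_one,
      ae_differentiableAt h'.ac_one] with t h0 h1 h2 h3 h4
    simp only [h0, Pi.add_apply, h1, h2, quasiDeriv2, deriv_add h3 h4]
    ring

theorem IsMaxPair.smul {a b : ℝ} {p Q : ℝ → ℂ} {y f : L2 a b} {u v : ℝ → ℂ} (c : ℂ)
    (h : IsMaxPair a b p Q y f u v) :
    IsMaxPair a b p Q (c • y) (c • f) (c • u) (c • v) where
  ac_zero := h.ac_zero.const_smul c
  ac_one := h.ac_one.const_smul c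
  rep_zero := (Lp.coeFn_smul c y).trans (h.rep_zero.const_smul c)
  rep_one := by
    filter_upwards [h.rep_one, ae_differentiableAt h.ac_zero] with t h1 h3
    simp only [Pi.smul_apply, h1, quasiDeriv, deriv_const_smul c h3, smul_eq_mul]
    ring
  rep_two := by
    filter_upwards [Lp.coeFn_smul c f, h.rep_two, ae_differentiableAt h.ac_one] with t h0 h1 h3
    simp only [h0, Pi.smul_apply, h1, quasiDeriv2, deriv_const_smul c h3, smul_eq_mul]
    ring

theorem IsMaxPair.zero (a b : ℝ) (p Q : ℝ → ℂ) : IsMaxPair a b p Q 0 0 0 0 := by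
  have h0 : AbsolutelyContinuousOnInterval (0 : ℝ → ℂ) a b := by
    rw [absolutelyContinuousOnInterval_iff]
    exact fun ε hε => ⟨1, one_pos, fun E _ _ => by simpa using hε⟩
  refine ⟨h0, h0, Lp.coeFn_zero _ _ _, ?_, ?_⟩
  · filter_upwards with t
    simp [quasiDeriv]
  · filter_upwards [Lp.coeFn_zero ℂ 2 (volume.restrict (Ioo a b))] with t ht
    exact ht.trans (by simp [quasiDeriv2])

/-- The graph of the restriction of the maximal operator to those `y` in its domain that satisfy
the boundary condition `α (y(a), D^[1]y(a)) + β (y(b), D^[1]y(b)) = 0`. -/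
def boundaryGraph (a b : ℝ) (p Q : ℝ → ℂ) (α β : Matrix (Fin 2) (Fin 2) ℂ) :
    Submodule ℂ (L2 a b × L2 a b) where
  carrier := {x | ∃ u v : ℝ → ℂ, IsMaxPair a b p Q x.1 x.2 u v ∧
    α.mulVec ![u a, v a] + β.mulVec ![u b, v b] = 0}
  zero_mem' := ⟨0, 0, IsMaxPair.zero a b p Q, by simp⟩
  add_mem' := by
    rintro x x' ⟨u, v, h, hb⟩ ⟨u', v', h', hb'⟩
    refine ⟨u + u', v + v', h.add h', ?_⟩
    have e (t : ℝ) : ![(u + u') t, (v + v') t] = ![u t, v t] + ![u' t, v' t] := by simp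
    rw [e, e, Matrix.mulVec_add, Matrix.mulVec_add, add_add_add_comm, hb, hb', add_zero]
  smul_mem' := by
    rintro c x ⟨u, v, h, hb⟩
    refine ⟨c • u, c • v, h.smul c, ?_⟩
    have e (t : ℝ) : ![(c • u) t, (c • v) t] = c • ![u t, v t] := by simp
    rw [e, e, Matrix.mulVec_smul, Matrix.mulVec_smul, ← smul_add, hb, smul_zero]

/-- The regularized Sturm-Liouville operator `L y = l[y] = -D^[2] y` in `L₂((a, b), ℂ)` whose
domain consists of the `y` in the domain of the maximal operator with
`α (y(a), D^[1]y(a)) + β (y(b), D^[1]y(b)) = 0`. Its graph is `boundaryGraph`, see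
`graph_boundaryOperator`. -/
def boundaryOperator (a b : ℝ) (p Q : ℝ → ℂ) (α β : Matrix (Fin 2) (Fin 2) ℂ) :
    L2 a b →ₗ.[ℂ] L2 a b :=
  (boundaryGraph a b p Q α β).toLinearPMap

/-- A continuous function on `[a, b]` vanishing almost everywhere has zero derivative and value
on `(a, b)`. -/
theorem eqOn_zero_of_ae {a b : ℝ} {u : ℝ → ℂ} (hu : AbsolutelyContinuousOnInterval u a b)
    (h0 : u =ᵐ[volume.restrict (Ioo a b)] 0) :
    ∀ t ∈ Ioo a b, u t = 0 ∧ deriv u t = 0 := by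
  have hc : ContinuousOn u (Ioo a b) :=
    hu.continuousOn.mono (Ioo_subset_Icc_self.trans Icc_subset_uIcc)
  have he : EqOn u 0 (Ioo a b) :=
    Measure.eqOn_open_of_ae_eq h0 isOpen_Ioo hc continuousOn_const
  intro t ht
  refine ⟨he ht, ?_⟩
  have : u =ᶠ[𝓝 t] fun _ => 0 := by
    filter_upwards [isOpen_Ioo.mem_nhds ht] with s hs using he hs
  rw [this.deriv_eq]
  simp

/-- The operator is well defined: `l[y]` is determined by `y`. -/
theorem boundaryGraph_snd_eq_zero (a b : ℝ) (p Q : ℝ → ℂ) (α β : Matrix (Fin 2) (Fin 2) ℂ)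
    (x : L2 a b × L2 a b) (hx : x ∈ boundaryGraph a b p Q α β) (h0 : x.1 = 0) : x.2 = 0 := by
  obtain ⟨u, v, h, -⟩ := hx
  have hu : u =ᵐ[volume.restrict (Ioo a b)] 0 := by
    refine h.rep_zero.symm.trans ?_
    rw [h0]
    exact Lp.coeFn_zero _ _ _
  have hu' := eqOn_zero_of_ae h.ac_zero hu
  have hv : v =ᵐ[volume.restrict (Ioo a b)] 0 := by
    filter_upwards [h.rep_one, ae_restrict_mem measurableSet_Ioo] with t h1 ht
    simp [h1, quasiDeriv, hu' t ht]
  have hv' := eqOn_zero_of_ae h.ac_one hv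
  rw [Lp.eq_zero_iff_ae_eq_zero]
  filter_upwards [h.rep_two, ae_restrict_mem measurableSet_Ioo] with t h1 ht
  simp [h1, quasiDeriv2, hu' t ht, hv' t ht]

theorem graph_boundaryOperator (a b : ℝ) (p Q : ℝ → ℂ) (α β : Matrix (Fin 2) (Fin 2) ℂ) :
    (boundaryOperator a b p Q α β).graph = boundaryGraph a b p Q α β :=
  Submodule.toLinearPMap_graph_eq _ (boundaryGraph_snd_eq_zero a b p Q α β)

section Resolvent

variable {H : Type*} [NormedAddCommGroup H] [NormedSpace ℂ H]

/-- `R` is the bounded, everywhere defined, two-sided inverse `(L - μ)⁻¹` of the (in general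
unbounded) operator `L - μ`. -/
def IsResolventAt (L : H →ₗ.[ℂ] H) (μ : ℂ) (R : H →L[ℂ] H) : Prop :=
  (∀ f : H, ∃ h : R f ∈ L.domain, L ⟨R f, h⟩ - μ • R f = f) ∧
    ∀ y : L.domain, R (L y - μ • (y : H)) = y

/-- The resolvent set `ρ(L)`. -/
def resolventSet (L : H →ₗ.[ℂ] H) : Set ℂ := {μ | ∃ R : H →L[ℂ] H, IsResolventAt L μ R}

open Classical in
/-- The resolvent `(L - μ)⁻¹` for `μ ∈ ρ(L)` (and `0` for other `μ`). -/
def resolvent (L : H →ₗ.[ℂ] H) (μ : ℂ) : H →L[ℂ] H :=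
  if h : ∃ R : H →L[ℂ] H, IsResolventAt L μ R then h.choose else 0

/-- The resolvent is determined by its defining property. -/
theorem IsResolventAt.resolvent_eq {L : H →ₗ.[ℂ] H} {μ : ℂ} {R : H →L[ℂ] H}
    (hR : IsResolventAt L μ R) : resolvent L μ = R := by
  have hex : ∃ R : H →L[ℂ] H, IsResolventAt L μ R := ⟨R, hR⟩
  rw [resolvent, dif_pos hex]
  ext f
  obtain ⟨h, hf⟩ := hR.1 f
  have := hex.choose_spec.2 ⟨R f, h⟩
  rwa [hf] at this

/-- Norm resolvent convergence `L ε → L 0` as `ε → 0+`: there is `μ ∈ ρ(L 0)` with `μ ∈ ρ(L ε)` for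
all sufficiently small `ε > 0` and `‖(L ε - μ)⁻¹ - (L 0 - μ)⁻¹‖ → 0`. -/
def NormResolventConverges (L : ℝ → H →ₗ.[ℂ] H) : Prop :=
  ∃ μ ∈ resolventSet (L 0), (∀ᶠ ε in 𝓝[>] (0 : ℝ), μ ∈ resolventSet (L ε)) ∧
    Tendsto (fun ε => ‖resolvent (L ε) μ - resolvent (L 0) μ‖) (𝓝[>] 0) (𝓝 0)

end Resolvent

end SturmLiouville

end

/-!
The resolvent equation `(L - μ) y = f` is a boundary value problem for the first order system
`u' = (Q/p) u + (1/p) v`, `v' = -(Q²/p + μ) u - (Q/p) v - f`, where `u = y` and `v = D^[1] y`. After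
integration, the system and the boundary condition together become one equation
`(1 - K) (u, v) = (0, -∫ₐ f)` for a pair of continuous functions on `[a, b]`
(`one_sub_bvpOp_apply_eq_iff`, `isMaxPair_of_eq_integral`, `IsMaxPair.eq_integral`). Here `K` is
built from evaluations at `a` and `b`, the entries of `α` and `β`, and the Volterra operators
`J(k) u = ∫ₐ k u` with `k = 1/p, Q/p, Q²/p + μ`.

Two facts about `K` carry the proof. First, `‖J(k) - J(l)‖ ≤ ‖k - l‖` with the norm of `L₁` on the
right (`norm_volterra_sub_le`), so under the hypotheses `K` converges in operator norm as
`ε → 0+`. Second, `K` is compact, by the Arzelà-Ascoli theorem (`isCompactOperator_volterra`).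

If `1 - K` is invertible, then `μ ∈ ρ(L)` and the resolvent is `f ↦ ((1 - K)⁻¹ (0, -∫ₐ f)).1`
(`isResolventAt_solutionOp`). Conversely, for `μ ∈ ρ(L)` the operator `1 - K` is injective, hence
invertible by the Fredholm alternative (`isUnit_charOp`). So for `μ ∈ ρ(L₀)` the operator `1 - K₀`
is invertible; invertibility is stable in norm and inversion is continuous
(`tendsto_inverse_charOp`), which gives convergence of the resolvents at `μ`. No fundamental matrix
or Green function is needed.

The space of continuous functions on `[a, b]` is encoded as `Icc a b →ᵇ ℂ`, and `IccExtend` turns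
its elements into functions on `ℝ`.
-/

noncomputable section

namespace SturmLiouville

open scoped BoundedContinuousFunction

/-! ### Absolutely continuous primitives -/

theorem intervalIntegrable_of_mem {E : Type*} [NormedAddCommGroup E] {a b : ℝ} (hab : a ≤ b)
    {g : ℝ → E} (hg : IntegrableOn g (Ioo a b)) {s t : ℝ} (hs : s ∈ Icc a b) (ht : t ∈ Icc a b) :
    IntervalIntegrable g volume s t :=
  ((intervalIntegrable_iff_integrableOn_Ioo_of_le hab).2 hg).mono_set
    (by rw [uIcc_of_le hab]; exact uIcc_subset_Icc hs ht)

theorem norm_integral_sub_le {a b : ℝ} (hab : a ≤ b) {g : ℝ → ℂ} (hg : IntegrableOn g (Ioo a b))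
    {s t : ℝ} (hs : s ∈ Icc a b) (ht : t ∈ Icc a b) :
    ‖(∫ x in a..s, g x) - ∫ x in a..t, g x‖ ≤ |(∫ x in a..s, ‖g x‖) - ∫ x in a..t, ‖g x‖| := by
  have ha : a ∈ Icc a b := left_mem_Icc.2 hab
  rw [intervalIntegral.integral_interval_sub_left (intervalIntegrable_of_mem hab hg ha hs)
      (intervalIntegrable_of_mem hab hg ha ht),
    intervalIntegral.integral_interval_sub_left (intervalIntegrable_of_mem hab hg.norm ha hs)
      (intervalIntegrable_of_mem hab hg.norm ha ht)]
  exact intervalIntegral.norm_integral_le_abs_integral_norm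

theorem norm_integral_le_of_integrableOn {a b : ℝ} (hab : a ≤ b) {g : ℝ → ℂ}
    (hg : IntegrableOn g (Ioo a b)) {t : ℝ} (ht : t ∈ Icc a b) :
    ‖∫ x in a..t, g x‖ ≤ ∫ x in Ioo a b, ‖g x‖ := by
  rw [← integral_Ioc_eq_integral_Ioo, ← intervalIntegral.integral_of_le hab]
  exact (intervalIntegral.norm_integral_le_integral_norm ht.1).trans
    (intervalIntegral.integral_mono_interval le_rfl ht.1 ht.2
      (ae_of_all _ fun x => norm_nonneg _)
      (intervalIntegrable_of_mem hab hg.norm (left_mem_Icc.2 hab) (right_mem_Icc.2 hab)))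

/-- Mathlib proves that primitives are absolutely continuous only for real integrands; the complex
case follows by comparison with the primitive of the norm. -/
theorem absolutelyContinuousOnInterval_integral {a b : ℝ} (hab : a ≤ b) {g : ℝ → ℂ}
    (hg : IntegrableOn g (Ioo a b)) :
    AbsolutelyContinuousOnInterval (fun t => ∫ x in a..t, g x) a b := by
  have hn : AbsolutelyContinuousOnInterval (fun t => ∫ x in a..t, ‖g x‖) a b :=
    (intervalIntegrable_of_mem hab hg.norm (left_mem_Icc.2 hab)
      (right_mem_Icc.2 hab)).absolutelyContinuousOnInterval_intervalIntegral left_mem_uIcc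
  unfold AbsolutelyContinuousOnInterval at hn ⊢
  refine squeeze_zero' (Eventually.of_forall fun _ => Finset.sum_nonneg fun _ _ => dist_nonneg)
    ?_ hn
  rw [eventually_inf_principal]
  refine Eventually.of_forall fun E hE => Finset.sum_le_sum fun i hi => ?_
  have h := hE.1 i hi
  rw [uIcc_of_le hab] at h
  rw [dist_eq_norm, Real.dist_eq]
  exact norm_integral_sub_le hab hg h.1 h.2

theorem ae_hasDerivAt_integral_Ioo {a b : ℝ} (hab : a ≤ b) {g : ℝ → ℂ}
    (hg : IntegrableOn g (Ioo a b)) :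
    ∀ᵐ t ∂volume.restrict (Ioo a b), HasDerivAt (fun t => ∫ x in a..t, g x) (g t) t := by
  rw [ae_restrict_iff' measurableSet_Ioo]
  filter_upwards [(intervalIntegrable_of_mem hab hg (left_mem_Icc.2 hab)
    (right_mem_Icc.2 hab)).ae_hasDerivAt_integral] with t ht h
  exact ht (Icc_subset_uIcc (Ioo_subset_Icc_self h)) a left_mem_uIcc

theorem eq_add_integral_of_deriv_ae_eq {a b : ℝ} (hab : a ≤ b) {u g : ℝ → ℂ}
    (hu : AbsolutelyContinuousOnInterval u a b) (hg : IntegrableOn g (Ioo a b))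
    (h : deriv u =ᵐ[volume.restrict (Ioo a b)] g) {t : ℝ} (ht : t ∈ Icc a b) :
    u t = u a + ∫ x in a..t, g x := by
  have hd : ∀ᵐ t, t ∈ uIcc a b → HasDerivAt (fun t => u t - ∫ x in a..t, g x) 0 t := by
    have h0 : ∀ᵐ t ∂volume.restrict (Ioo a b),
        HasDerivAt (fun t => u t - ∫ x in a..t, g x) 0 t := by
      filter_upwards [h, ae_differentiableAt hu, ae_hasDerivAt_integral_Ioo hab hg] with t h1 h2 h3
      have h4 := h2.hasDerivAt.sub h3
      rw [h1, sub_self] at h4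
      exact h4
    rw [uIcc_of_le hab, ← ae_restrict_iff' measurableSet_Icc]
    rwa [restrict_Ioo_eq_restrict_Icc] at h0
  obtain ⟨C, hC⟩ := (hu.sub
    (absolutelyContinuousOnInterval_integral hab hg)).const_of_ae_hasDerivAt_zero hd
  have e1 := hC t (Icc_subset_uIcc ht)
  have e2 := hC a left_mem_uIcc
  simp only [Pi.sub_apply, intervalIntegral.integral_same, sub_zero] at e1 e2
  rw [e2, ← e1]
  ring

/-! ### Volterra operators on the continuous functions -/

/-- The primitive `t ↦ ∫ₐᵗ g` of an integrable function, as a continuous function on `[a, b]`. -/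
def primitive {a b : ℝ} (hab : a ≤ b) (g : ℝ → ℂ) (hg : IntegrableOn g (Ioo a b)) :
    Icc a b →ᵇ ℂ :=
  BoundedContinuousFunction.mkOfCompact
    { toFun := fun t => ∫ x in a..t, g x
      continuous_toFun := by
        have := (absolutelyContinuousOnInterval_integral hab hg).continuousOn
        rw [uIcc_of_le hab] at this
        exact this.domRestrict }

@[simp]
theorem primitive_apply {a b : ℝ} (hab : a ≤ b) (g : ℝ → ℂ) (hg : IntegrableOn g (Ioo a b))
    (t : Icc a b) : primitive hab g hg t = ∫ x in a..t, g x := rfl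

theorem norm_primitive_le {a b : ℝ} (hab : a ≤ b) (g : ℝ → ℂ) (hg : IntegrableOn g (Ioo a b)) :
    ‖primitive hab g hg‖ ≤ ∫ x in Ioo a b, ‖g x‖ :=
  (BoundedContinuousFunction.norm_le (integral_nonneg fun _ => norm_nonneg _)).2 fun t =>
    norm_integral_le_of_integrableOn hab hg t.2

theorem norm_IccExtend_le {a b : ℝ} (hab : a ≤ b) (u : Icc a b →ᵇ ℂ) (t : ℝ) :
    ‖IccExtend hab u t‖ ≤ ‖u‖ :=
  u.norm_coe_le_norm _

theorem continuous_IccExtend {a b : ℝ} (hab : a ≤ b) (u : Icc a b →ᵇ ℂ) :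
    Continuous (IccExtend hab u) :=
  u.continuous.Icc_extend'

theorem integrableOn_mul_IccExtend {a b : ℝ} (hab : a ≤ b) {k : ℝ → ℂ}
    (hk : IntegrableOn k (Ioo a b)) (u : Icc a b →ᵇ ℂ) :
    IntegrableOn (fun t => k t * IccExtend hab u t) (Ioo a b) :=
  Integrable.mul_bdd hk (continuous_IccExtend hab u).aestronglyMeasurable
    (ae_of_all _ (norm_IccExtend_le hab u))

open Classical in
/-- The Volterra operator `u ↦ (t ↦ ∫ₐᵗ k u)` on `C([a, b], ℂ)` with kernel `k ∈ L₁`. It is `0` if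
`k` is not integrable, so that it is defined for every parameter of a family of kernels. -/
def volterra {a b : ℝ} (hab : a ≤ b) (k : ℝ → ℂ) : (Icc a b →ᵇ ℂ) →L[ℂ] (Icc a b →ᵇ ℂ) :=
  if hk : IntegrableOn k (Ioo a b) then
    LinearMap.mkContinuous
      { toFun := fun u => primitive hab _ (integrableOn_mul_IccExtend hab hk u)
        map_add' := fun u v => by
          ext t
          have ha : a ∈ Icc a b := left_mem_Icc.2 hab
          simp only [primitive_apply, BoundedContinuousFunction.add_apply]
          rw [← intervalIntegral.integral_add
            (intervalIntegrable_of_mem hab (integrableOn_mul_IccExtend hab hk u) ha t.2)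
            (intervalIntegrable_of_mem hab (integrableOn_mul_IccExtend hab hk v) ha t.2)]
          exact intervalIntegral.integral_congr fun x _ => by simp [IccExtend, mul_add]
        map_smul' := fun c u => by
          ext t
          simp only [primitive_apply, BoundedContinuousFunction.smul_apply, RingHom.id_apply]
          rw [← intervalIntegral.integral_smul]
          exact intervalIntegral.integral_congr fun x _ => by simp [IccExtend, mul_left_comm] }
      (∫ x in Ioo a b, ‖k x‖) fun u => by
        refine (norm_primitive_le hab _ (integrableOn_mul_IccExtend hab hk u)).trans ?_
        rw [← integral_mul_const]
        refine integral_mono (integrableOn_mul_IccExtend hab hk u).norm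
          (hk.norm.mul_const _) fun x => ?_
        simp only [norm_mul]
        exact mul_le_mul_of_nonneg_left (norm_IccExtend_le hab u x) (norm_nonneg _)
  else 0

theorem volterra_apply {a b : ℝ} (hab : a ≤ b) {k : ℝ → ℂ} (hk : IntegrableOn k (Ioo a b))
    (u : Icc a b →ᵇ ℂ) (t : Icc a b) :
    volterra hab k u t = ∫ x in a..t, k x * IccExtend hab u x := by
  rw [volterra, dif_pos hk]
  rfl

theorem norm_volterra_sub_le {a b : ℝ} (hab : a ≤ b) {k l : ℝ → ℂ}
    (hk : IntegrableOn k (Ioo a b)) (hl : IntegrableOn l (Ioo a b)) :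
    ‖volterra hab k - volterra hab l‖ ≤ ∫ x in Ioo a b, ‖k x - l x‖ := by
  have h0 : 0 ≤ ∫ x in Ioo a b, ‖k x - l x‖ := integral_nonneg fun _ => norm_nonneg _
  have hkl : IntegrableOn (fun x => k x - l x) (Ioo a b) := hk.sub hl
  refine ContinuousLinearMap.opNorm_le_bound _ h0 fun u => ?_
  refine (BoundedContinuousFunction.norm_le (by positivity)).2 fun t => ?_
  have ha : a ∈ Icc a b := left_mem_Icc.2 hab
  rw [sub_apply, BoundedContinuousFunction.sub_apply, volterra_apply hab hk, volterra_apply hab hl,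
    ← intervalIntegral.integral_sub
      (intervalIntegrable_of_mem hab (integrableOn_mul_IccExtend hab hk u) ha t.2)
      (intervalIntegrable_of_mem hab (integrableOn_mul_IccExtend hab hl u) ha t.2)]
  simp only [← sub_mul]
  refine (norm_integral_le_of_integrableOn hab
    (integrableOn_mul_IccExtend hab hkl u) t.2).trans ?_
  rw [← integral_mul_const]
  refine integral_mono (integrableOn_mul_IccExtend hab hkl u).norm
    (hkl.norm.mul_const _) fun x => ?_
  simp only [norm_mul]
  exact mul_le_mul_of_nonneg_left (norm_IccExtend_le hab u x) (norm_nonneg _)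

theorem tendsto_volterra {a b : ℝ} (hab : a ≤ b) {ι : Type*} {F : Filter ι} {k : ι → ℝ → ℂ}
    {l : ℝ → ℂ} (hk : ∀ᶠ i in F, IntegrableOn (k i) (Ioo a b)) (hl : IntegrableOn l (Ioo a b))
    (h : Tendsto (fun i => ∫ x in Ioo a b, ‖k i x - l x‖) F (𝓝 0)) :
    Tendsto (fun i => volterra hab (k i)) F (𝓝 (volterra hab l)) := by
  rw [tendsto_iff_norm_sub_tendsto_zero]
  exact squeeze_zero' (Eventually.of_forall fun _ => norm_nonneg _)
    (hk.mono fun i hi => norm_volterra_sub_le hab hi hl) h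

/-- By the Arzelà-Ascoli theorem: the images of the functions `u` with `‖u‖ < 1` share the modulus
of continuity `|∫ₛᵗ ‖k‖|`. -/
theorem isCompactOperator_volterra {a b : ℝ} (hab : a ≤ b) {k : ℝ → ℂ}
    (hk : IntegrableOn k (Ioo a b)) : IsCompactOperator (volterra hab k) := by
  refine (isCompactOperator_iff_isCompact_closure_image_ball
    (volterra hab k).toLinearMap one_pos).2 ?_
  refine BoundedContinuousFunction.arzela_ascoli
    (Metric.closedBall 0 ‖volterra hab k‖) (isCompact_closedBall _ _) _ ?_ ?_
  · rintro f t ⟨u, hu, rfl⟩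
    rw [mem_ball_zero_iff] at hu
    rw [mem_closedBall_zero_iff]
    refine ((volterra hab k u).norm_coe_le_norm t).trans ?_
    exact ((volterra hab k).le_opNorm u).trans
      (mul_le_of_le_one_right (norm_nonneg _) hu.le)
  · intro s
    have hn : Continuous fun t : Icc a b => ∫ x in a..(t : ℝ), ‖k x‖ := by
      have := ((intervalIntegrable_of_mem hab hk.norm (left_mem_Icc.2 hab)
        (right_mem_Icc.2 hab)).absolutelyContinuousOnInterval_intervalIntegral
        left_mem_uIcc).continuousOn
      rw [uIcc_of_le hab] at this
      exact this.domRestrict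
    refine Metric.equicontinuousAt_of_continuity_modulus
      (fun t : Icc a b => |(∫ x in a..(s : ℝ), ‖k x‖) - ∫ x in a..(t : ℝ), ‖k x‖|) ?_ _
      (Eventually.of_forall ?_)
    · have h : Continuous fun t : Icc a b =>
          |(∫ x in a..(s : ℝ), ‖k x‖) - ∫ x in a..(t : ℝ), ‖k x‖| :=
        (continuous_const.sub hn).abs
      simpa using h.tendsto s
    · rintro t ⟨f, u, hu, rfl⟩
      rw [mem_ball_zero_iff] at hu
      change dist (volterra hab k u s) (volterra hab k u t) ≤ _
      rw [dist_eq_norm, volterra_apply hab hk, volterra_apply hab hk]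
      have ha : a ∈ Icc a b := left_mem_Icc.2 hab
      have hku := integrableOn_mul_IccExtend hab hk u
      rw [intervalIntegral.integral_interval_sub_left (intervalIntegrable_of_mem hab hku ha s.2)
          (intervalIntegrable_of_mem hab hku ha t.2),
        intervalIntegral.integral_interval_sub_left
          (intervalIntegrable_of_mem hab hk.norm ha s.2)
          (intervalIntegrable_of_mem hab hk.norm ha t.2)]
      refine intervalIntegral.norm_integral_le_abs_of_norm_le (ae_of_all _ fun x => ?_)
        (intervalIntegrable_of_mem hab hk.norm t.2 s.2)
      rw [norm_mul]
      exact mul_le_of_le_one_right (norm_nonneg _) ((norm_IccExtend_le hab u x).trans hu.le)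

/-! ### Passage between square integrable and continuous functions -/

theorem integral_congr_ae_Ioo {a b : ℝ} {f g : ℝ → ℂ} (h : f =ᵐ[volume.restrict (Ioo a b)] g)
    {t : ℝ} (ht : t ∈ Icc a b) : ∫ x in a..t, f x = ∫ x in a..t, g x := by
  rw [restrict_Ioo_eq_restrict_Ioc] at h
  rw [intervalIntegral.integral_of_le ht.1, intervalIntegral.integral_of_le ht.1]
  exact integral_congr_ae (ae_restrict_of_ae_restrict_of_subset (Ioc_subset_Ioc_right ht.2) h)

theorem integrableOn_L2 {a b : ℝ} (f : L2 a b) : IntegrableOn f (Ioo a b) :=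
  (Lp.memLp f).integrable (by norm_num)

/-- The primitive `f ↦ (t ↦ ∫ₐᵗ f)` as a bounded operator from `L₂` to `C([a, b], ℂ)`. -/
def primitiveL2 {a b : ℝ} (hab : a ≤ b) : L2 a b →L[ℂ] (Icc a b →ᵇ ℂ) :=
  LinearMap.mkContinuous
    { toFun := fun f => primitive hab f (integrableOn_L2 f)
      map_add' := fun f g => by
        ext t
        have ha : a ∈ Icc a b := left_mem_Icc.2 hab
        simp only [primitive_apply, BoundedContinuousFunction.add_apply]
        rw [← intervalIntegral.integral_add
          (intervalIntegrable_of_mem hab (integrableOn_L2 f) ha t.2)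
          (intervalIntegrable_of_mem hab (integrableOn_L2 g) ha t.2)]
        exact integral_congr_ae_Ioo (Lp.coeFn_add f g) t.2
      map_smul' := fun c f => by
        ext t
        simp only [primitive_apply, BoundedContinuousFunction.smul_apply, RingHom.id_apply]
        rw [← intervalIntegral.integral_smul]
        exact integral_congr_ae_Ioo (Lp.coeFn_smul c f) t.2 }
    (((volume.restrict (Ioo a b)) univ ^ (1 / 2 : ℝ)).toReal) fun f => by
      refine (norm_primitive_le hab f (integrableOn_L2 f)).trans ?_
      have h := eLpNorm_le_eLpNorm_mul_rpow_measure_univ (p := 1) (q := 2) (by norm_num)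
        (Lp.aestronglyMeasurable f)
      have e : (1 / (1 : ENNReal).toReal - 1 / (2 : ENNReal).toReal : ℝ) = 1 / 2 := by norm_num
      rw [e] at h
      rw [integral_norm_eq_lintegral_enorm (Lp.aestronglyMeasurable f),
        ← eLpNorm_one_eq_lintegral_enorm, mul_comm, Lp.norm_def, ← ENNReal.toReal_mul]
      exact ENNReal.toReal_mono (ENNReal.mul_ne_top (Lp.eLpNorm_ne_top f)
        (ENNReal.rpow_ne_top_of_nonneg (by norm_num) (measure_ne_top _ _))) h

theorem primitiveL2_apply {a b : ℝ} (hab : a ≤ b) (f : L2 a b) (t : Icc a b) :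
    primitiveL2 hab f t = ∫ x in a..t, f x := rfl

theorem memLp_IccExtend {a b : ℝ} (hab : a ≤ b) (u : Icc a b →ᵇ ℂ) :
    MemLp (IccExtend hab u) 2 (volume.restrict (Ioo a b)) :=
  MemLp.of_bound (continuous_IccExtend hab u).aestronglyMeasurable ‖u‖
    (ae_of_all _ (norm_IccExtend_le hab u))

/-- The inclusion of `C([a, b], ℂ)` in `L₂`. -/
def toL2 {a b : ℝ} (hab : a ≤ b) : (Icc a b →ᵇ ℂ) →L[ℂ] L2 a b :=
  LinearMap.mkContinuous
    { toFun := fun u => (memLp_IccExtend hab u).toLp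
      map_add' := fun u v => by
        rw [← MemLp.toLp_add]
        rfl
      map_smul' := fun c u => by
        rw [RingHom.id_apply, ← MemLp.toLp_const_smul]
        rfl }
    (measureUnivNNReal (volume.restrict (Ioo a b)) ^ (2 : ENNReal).toReal⁻¹) fun u =>
      Lp.norm_le_of_ae_bound (norm_nonneg u) (by
        filter_upwards [(memLp_IccExtend hab u).coeFn_toLp] with t ht
        exact (congrArg norm ht).trans_le (norm_IccExtend_le hab u t))

theorem coeFn_toL2 {a b : ℝ} (hab : a ≤ b) (u : Icc a b →ᵇ ℂ) :
    toL2 hab u =ᵐ[volume.restrict (Ioo a b)] IccExtend hab u :=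
  (memLp_IccExtend hab u).coeFn_toLp

/-! ### The boundary value problem as an operator equation -/

/-- The operator taking `u` to the constant function with value `u t`. -/
def constEval {a b : ℝ} (t : Icc a b) : (Icc a b →ᵇ ℂ) →L[ℂ] (Icc a b →ᵇ ℂ) :=
  (BoundedContinuousFunction.evalCLM ℂ t).smulRight 1

@[simp]
theorem constEval_apply {a b : ℝ} (t s : Icc a b) (u : Icc a b →ᵇ ℂ) :
    constEval t u s = u t := by
  simp [constEval]

theorem isCompactOperator_constEval {a b : ℝ} (t : Icc a b) :
    IsCompactOperator (constEval t) :=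
  (isCompactOperator_of_locallyCompactSpace_rng
    (ContinuousLinearMap.toSpanSingleton ℂ (1 : Icc a b →ᵇ ℂ))).comp_clm
    (BoundedContinuousFunction.evalCLM ℂ t)

section SystemOp

variable {E : Type*} [NormedAddCommGroup E] [NormedSpace ℂ E]

/-- The `i`-th row of the boundary form `α (u(a), v(a)) + β (u(b), v(b))`, as a function of the pair
`(u, v)`. Here `A` and `B` stand for the evaluations at `a` and `b`. -/
def boundaryForm (A B : E →L[ℂ] E) (α β : Matrix (Fin 2) (Fin 2) ℂ) (i : Fin 2) : E × E →L[ℂ] E :=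
  (α i 0 • A + β i 0 • B) ∘L .fst ℂ E E + (α i 1 • A + β i 1 • B) ∘L .snd ℂ E E

/-- The operator `K` on pairs for which `(u, v) = K (u, v) + g` expresses both the boundary
condition and the integrated first order system `u' = k₂ u + k₁ v`, `v' = -k₃ u - k₂ v`. Here `A`
and `B` stand for the evaluations at `a` and `b`, and the `Jᵢ` for the Volterra operators with
kernels `kᵢ`. At `t = a` the latter vanish, so that for `g(a) = 0` the equation contains the
boundary condition. -/
def systemOp (A B : E →L[ℂ] E) (α β : Matrix (Fin 2) (Fin 2) ℂ) (J₁ J₂ J₃ : E →L[ℂ] E) :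
    E × E →L[ℂ] E × E :=
  .inl ℂ E E ∘L ((A + J₂) ∘L .fst ℂ E E + J₁ ∘L .snd ℂ E E - boundaryForm A B α β 0) +
    .inr ℂ E E ∘L ((A - J₂) ∘L .snd ℂ E E - J₃ ∘L .fst ℂ E E - boundaryForm A B α β 1)

theorem isCompactOperator_boundaryForm {A B : E →L[ℂ] E} (hA : IsCompactOperator A)
    (hB : IsCompactOperator B) (α β : Matrix (Fin 2) (Fin 2) ℂ) (i : Fin 2) :
    IsCompactOperator (boundaryForm A B α β i) :=
  (IsCompactOperator.comp_clm (f := α i 0 • A + β i 0 • B) ((hA.smul _).add (hB.smul _)) _).add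
    (IsCompactOperator.comp_clm (f := α i 1 • A + β i 1 • B) ((hA.smul _).add (hB.smul _)) _)

theorem isCompactOperator_systemOp {A B J₁ J₂ J₃ : E →L[ℂ] E} (hA : IsCompactOperator A)
    (hB : IsCompactOperator B) (α β : Matrix (Fin 2) (Fin 2) ℂ) (h₁ : IsCompactOperator J₁)
    (h₂ : IsCompactOperator J₂) (h₃ : IsCompactOperator J₃) :
    IsCompactOperator (systemOp A B α β J₁ J₂ J₃) := by
  have hF := isCompactOperator_boundaryForm hA hB α β
  have c₁ : IsCompactOperator
      ((A + J₂) ∘L .fst ℂ E E + J₁ ∘L .snd ℂ E E - boundaryForm A B α β 0) :=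
    ((IsCompactOperator.comp_clm (f := A + J₂) (hA.add h₂) _).add (h₁.comp_clm _)).sub (hF 0)
  have c₂ : IsCompactOperator
      ((A - J₂) ∘L .snd ℂ E E - J₃ ∘L .fst ℂ E E - boundaryForm A B α β 1) :=
    ((IsCompactOperator.comp_clm (f := A - J₂) (hA.sub h₂) _).sub (h₃.comp_clm _)).sub (hF 1)
  exact (c₁.clm_comp (.inl ℂ E E)).add (c₂.clm_comp (.inr ℂ E E))

theorem tendsto_systemOp (A B : E →L[ℂ] E) {ι : Type*} {F : Filter ι}
    {α β : ι → Matrix (Fin 2) (Fin 2) ℂ} {α₀ β₀ : Matrix (Fin 2) (Fin 2) ℂ}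
    {J₁ J₂ J₃ : ι → E →L[ℂ] E} {T₁ T₂ T₃ : E →L[ℂ] E}
    (hα : Tendsto α F (𝓝 α₀)) (hβ : Tendsto β F (𝓝 β₀)) (h₁ : Tendsto J₁ F (𝓝 T₁))
    (h₂ : Tendsto J₂ F (𝓝 T₂)) (h₃ : Tendsto J₃ F (𝓝 T₃)) :
    Tendsto (fun i => systemOp A B (α i) (β i) (J₁ i) (J₂ i) (J₃ i)) F
      (𝓝 (systemOp A B α₀ β₀ T₁ T₂ T₃)) := by
  have eα (i l : Fin 2) : Tendsto (fun j => α j i l) F (𝓝 (α₀ i l)) :=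
    ((continuous_id.matrix_elem i l).tendsto α₀).comp hα
  have eβ (i l : Fin 2) : Tendsto (fun j => β j i l) F (𝓝 (β₀ i l)) :=
    ((continuous_id.matrix_elem i l).tendsto β₀).comp hβ
  have hr {S : ι → E →L[ℂ] E} {S₀ : E →L[ℂ] E} (h : Tendsto S F (𝓝 S₀)) (R : E × E →L[ℂ] E) :
      Tendsto (fun j => S j ∘L R) F (𝓝 (S₀ ∘L R)) :=
    ((continuous_id.clm_comp_const R).tendsto S₀).comp h
  have hl {S : ι → E × E →L[ℂ] E} {S₀ : E × E →L[ℂ] E} (h : Tendsto S F (𝓝 S₀))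
      (R : E →L[ℂ] E × E) : Tendsto (fun j => R ∘L S j) F (𝓝 (R ∘L S₀)) :=
    ((continuous_id.const_clm_comp R).tendsto S₀).comp h
  have hF (i : Fin 2) : Tendsto (fun j => boundaryForm A B (α j) (β j) i) F
      (𝓝 (boundaryForm A B α₀ β₀ i)) :=
    (hr (((eα i 0).smul_const A).add ((eβ i 0).smul_const B)) _).add
      (hr (((eα i 1).smul_const A).add ((eβ i 1).smul_const B)) _)
  have c₁ := ((hr (h₂.const_add A) (.fst ℂ E E)).add (hr h₁ (.snd ℂ E E))).sub (hF 0)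
  have c₂ := ((hr (h₂.const_sub A) (.snd ℂ E E)).sub (hr h₃ (.fst ℂ E E))).sub (hF 1)
  exact (hl c₁ (.inl ℂ E E)).add (hl c₂ (.inr ℂ E E))

end SystemOp

/-- The operator `systemOp` on `C([a, b], ℂ)²` with kernels `k₁`, `k₂`, `k₃`. -/
def bvpOp {a b : ℝ} (hab : a ≤ b) (α β : Matrix (Fin 2) (Fin 2) ℂ) (k₁ k₂ k₃ : ℝ → ℂ) :
    (Icc a b →ᵇ ℂ) × (Icc a b →ᵇ ℂ) →L[ℂ] (Icc a b →ᵇ ℂ) × (Icc a b →ᵇ ℂ) :=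
  systemOp (constEval ⟨a, left_mem_Icc.2 hab⟩) (constEval ⟨b, right_mem_Icc.2 hab⟩) α β
    (volterra hab k₁) (volterra hab k₂) (volterra hab k₃)

theorem isCompactOperator_bvpOp {a b : ℝ} (hab : a ≤ b) (α β : Matrix (Fin 2) (Fin 2) ℂ)
    {k₁ k₂ k₃ : ℝ → ℂ} (h₁ : IntegrableOn k₁ (Ioo a b)) (h₂ : IntegrableOn k₂ (Ioo a b))
    (h₃ : IntegrableOn k₃ (Ioo a b)) : IsCompactOperator (bvpOp hab α β k₁ k₂ k₃) :=
  isCompactOperator_systemOp (isCompactOperator_constEval _) (isCompactOperator_constEval _) α β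
    (isCompactOperator_volterra hab h₁) (isCompactOperator_volterra hab h₂)
    (isCompactOperator_volterra hab h₃)

theorem tendsto_bvpOp {a b : ℝ} (hab : a ≤ b) {ι : Type*} {F : Filter ι}
    {α β : ι → Matrix (Fin 2) (Fin 2) ℂ} {α₀ β₀ : Matrix (Fin 2) (Fin 2) ℂ}
    {k₁ k₂ k₃ : ι → ℝ → ℂ} {l₁ l₂ l₃ : ℝ → ℂ}
    (hα : Tendsto α F (𝓝 α₀)) (hβ : Tendsto β F (𝓝 β₀))
    (h₁ : Tendsto (fun i => volterra hab (k₁ i)) F (𝓝 (volterra hab l₁)))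
    (h₂ : Tendsto (fun i => volterra hab (k₂ i)) F (𝓝 (volterra hab l₂)))
    (h₃ : Tendsto (fun i => volterra hab (k₃ i)) F (𝓝 (volterra hab l₃))) :
    Tendsto (fun i => bvpOp hab (α i) (β i) (k₁ i) (k₂ i) (k₃ i)) F
      (𝓝 (bvpOp hab α₀ β₀ l₁ l₂ l₃)) :=
  tendsto_systemOp _ _ hα hβ h₁ h₂ h₃

theorem boundaryForm_apply {a b : ℝ} (hab : a ≤ b) (α β : Matrix (Fin 2) (Fin 2) ℂ) (i : Fin 2)
    (w : (Icc a b →ᵇ ℂ) × (Icc a b →ᵇ ℂ)) (t : Icc a b) :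
    boundaryForm (constEval ⟨a, left_mem_Icc.2 hab⟩) (constEval ⟨b, right_mem_Icc.2 hab⟩) α β i
        w t =
      (α.mulVec ![IccExtend hab w.1 a, IccExtend hab w.2 a] +
        β.mulVec ![IccExtend hab w.1 b, IccExtend hab w.2 b]) i := by
  fin_cases i <;> simp [boundaryForm] <;> ring

/-- The operator equation is equivalent to the boundary condition together with the integrated
first order system. -/
theorem one_sub_bvpOp_apply_eq_iff {a b : ℝ} (hab : a ≤ b) (α β : Matrix (Fin 2) (Fin 2) ℂ)
    {k₁ k₂ k₃ : ℝ → ℂ} (h₁ : IntegrableOn k₁ (Ioo a b)) (h₂ : IntegrableOn k₂ (Ioo a b))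
    (h₃ : IntegrableOn k₃ (Ioo a b)) (f : L2 a b) (w : (Icc a b →ᵇ ℂ) × (Icc a b →ᵇ ℂ)) :
    (1 - bvpOp hab α β k₁ k₂ k₃) w =
        (0, -primitiveL2 hab f) ↔
      α.mulVec ![IccExtend hab w.1 a, IccExtend hab w.2 a] +
        β.mulVec ![IccExtend hab w.1 b, IccExtend hab w.2 b] = 0 ∧
      (∀ t ∈ Icc a b, IccExtend hab w.1 t = IccExtend hab w.1 a +
        ∫ x in a..t, (k₂ x * IccExtend hab w.1 x + k₁ x * IccExtend hab w.2 x)) ∧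
      (∀ t ∈ Icc a b, IccExtend hab w.2 t = IccExtend hab w.2 a +
        ∫ x in a..t, (-(k₃ x * IccExtend hab w.1 x) - k₂ x * IccExtend hab w.2 x - f x)) := by
  obtain ⟨u, v⟩ := w
  have ha : a ∈ Icc a b := left_mem_Icc.2 hab
  have i₁ := fun t : Icc a b =>
    intervalIntegrable_of_mem hab (integrableOn_mul_IccExtend hab h₁ v) ha t.2
  have i₂ := fun t : Icc a b =>
    intervalIntegrable_of_mem hab (integrableOn_mul_IccExtend hab h₂ u) ha t.2
  have i₃ := fun t : Icc a b =>
    intervalIntegrable_of_mem hab (integrableOn_mul_IccExtend hab h₃ u) ha t.2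
  have i₄ := fun t : Icc a b =>
    intervalIntegrable_of_mem hab (integrableOn_mul_IccExtend hab h₂ v) ha t.2
  have i₅ := fun t : Icc a b => intervalIntegrable_of_mem hab (integrableOn_L2 f) ha t.2
  set B := α.mulVec ![IccExtend hab u a, IccExtend hab v a] +
        β.mulVec ![IccExtend hab u b, IccExtend hab v b] with hB
  -- The two components of the equation at a point `t`.
  have key : (1 - bvpOp hab α β k₁ k₂ k₃) (u, v) =
        (0, -primitiveL2 hab f) ↔
      (∀ t : Icc a b, u t = IccExtend hab u a - B 0 +
        ∫ x in a..t, (k₂ x * IccExtend hab u x + k₁ x * IccExtend hab v x)) ∧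
      (∀ t : Icc a b, v t = IccExtend hab v a - B 1 +
        ∫ x in a..t, (-(k₃ x * IccExtend hab u x) - k₂ x * IccExtend hab v x - f x)) := by
    rw [Prod.ext_iff, DFunLike.ext_iff, DFunLike.ext_iff]
    refine and_congr (forall_congr' fun t => ?_) (forall_congr' fun t => ?_)
    · rw [intervalIntegral.integral_add (i₂ t) (i₁ t)]
      have e := boundaryForm_apply hab α β 0 (u, v) t
      simp only at e
      rw [← hB] at e
      have e2 : u ⟨a, ha⟩ = IccExtend hab u a := (IccExtend_left hab u).symm
      simp only [bvpOp, systemOp, sub_apply, one_apply_eq_self, add_apply,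
        ContinuousLinearMap.comp_apply, ContinuousLinearMap.inl_apply,
        ContinuousLinearMap.inr_apply, ContinuousLinearMap.coe_fst', ContinuousLinearMap.coe_snd',
        Prod.mk_add_mk, Prod.fst_sub, add_zero, BoundedContinuousFunction.sub_apply,
        BoundedContinuousFunction.add_apply, BoundedContinuousFunction.coe_zero, Pi.zero_apply,
        constEval_apply, e, e2, volterra_apply hab h₁, volterra_apply hab h₂]
      constructor <;> intro h <;> linear_combination h
    · have i₆ : IntervalIntegrable (fun x => -(k₃ x * IccExtend hab u x)) volume a t := (i₃ t).neg
      rw [intervalIntegral.integral_sub (i₆.sub (i₄ t)) (i₅ t),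
        intervalIntegral.integral_sub i₆ (i₄ t), intervalIntegral.integral_neg]
      have e := boundaryForm_apply hab α β 1 (u, v) t
      simp only at e
      rw [← hB] at e
      have e2 : v ⟨a, ha⟩ = IccExtend hab v a := (IccExtend_left hab v).symm
      simp only [bvpOp, systemOp, sub_apply, one_apply_eq_self, add_apply,
        ContinuousLinearMap.comp_apply, ContinuousLinearMap.inl_apply,
        ContinuousLinearMap.inr_apply, ContinuousLinearMap.coe_fst', ContinuousLinearMap.coe_snd',
        Prod.mk_add_mk, Prod.snd_sub, zero_add, BoundedContinuousFunction.sub_apply,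
        BoundedContinuousFunction.neg_apply, constEval_apply, e, e2,
        volterra_apply hab h₃, volterra_apply hab h₂, primitiveL2_apply]
      constructor <;> intro h <;> linear_combination h
  rw [key]
  constructor
  · rintro ⟨hu, hv⟩
    have e0 := hu ⟨a, ha⟩
    have e1 := hv ⟨a, ha⟩
    simp only [intervalIntegral.integral_same, IccExtend_left] at e0 e1
    have b0 : B 0 = 0 := by linear_combination e0
    have b1 : B 1 = 0 := by linear_combination e1
    refine ⟨?_, fun t ht => ?_, fun t ht => ?_⟩
    · ext i
      fin_cases i
      · exact b0
      · exact b1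
    · rw [IccExtend_of_mem _ _ ht, hu ⟨t, ht⟩, b0, sub_zero]
    · rw [IccExtend_of_mem _ _ ht, hv ⟨t, ht⟩, b1, sub_zero]
  · rintro ⟨hb, hu, hv⟩
    refine ⟨fun t => ?_, fun t => ?_⟩
    · rw [hb, Pi.zero_apply, sub_zero, ← hu t t.2, IccExtend_val]
    · rw [hb, Pi.zero_apply, sub_zero, ← hv t t.2, IccExtend_val]

/-! ### Solutions of the operator equation and the maximal operator -/

theorem _root_.AbsolutelyContinuousOnInterval.congr {X : Type*} [PseudoMetricSpace X] {a b : ℝ}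
    {f g : ℝ → X} (hf : AbsolutelyContinuousOnInterval f a b) (h : EqOn f g (uIcc a b)) :
    AbsolutelyContinuousOnInterval g a b := by
  unfold AbsolutelyContinuousOnInterval at hf ⊢
  refine hf.congr' ?_
  refine eventually_inf_principal.2 (Eventually.of_forall fun E hE => ?_)
  exact Finset.sum_congr rfl fun i hi => by rw [h (hE.1 i hi).1, h (hE.1 i hi).2]

theorem absolutelyContinuousOnInterval_of_eq_add_integral {a b : ℝ} (hab : a ≤ b) {u g : ℝ → ℂ}
    (hg : IntegrableOn g (Ioo a b)) (h : ∀ t ∈ Icc a b, u t = u a + ∫ x in a..t, g x) :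
    AbsolutelyContinuousOnInterval u a b := by
  have hc : AbsolutelyContinuousOnInterval (fun _ : ℝ => u a) a b :=
    ((LipschitzWith.const (u a)).lipschitzOnWith (s := uIcc a b)).absolutelyContinuousOnInterval
  refine (hc.add (absolutelyContinuousOnInterval_integral hab hg)).congr fun t ht => ?_
  rw [uIcc_of_le hab] at ht
  exact (h t ht).symm

theorem ae_deriv_eq_of_eq_add_integral {a b : ℝ} (hab : a ≤ b) {u g : ℝ → ℂ}
    (hg : IntegrableOn g (Ioo a b)) (h : ∀ t ∈ Icc a b, u t = u a + ∫ x in a..t, g x) :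
    deriv u =ᵐ[volume.restrict (Ioo a b)] g := by
  filter_upwards [ae_hasDerivAt_integral_Ioo hab hg, ae_restrict_mem measurableSet_Ioo] with t h1 ht
  refine ((h1.const_add (u a)).congr_of_eventuallyEq ?_).deriv
  filter_upwards [isOpen_Ioo.mem_nhds ht] with s hs using h s (Ioo_subset_Icc_self hs)

theorem integrableOn_mul_of_continuousOn {a b : ℝ} {k u : ℝ → ℂ}
    (hk : IntegrableOn k (Ioo a b)) (hu : ContinuousOn u (Icc a b)) :
    IntegrableOn (fun t => k t * u t) (Ioo a b) := by
  rw [← integrableOn_Icc_iff_integrableOn_Ioo] at hk ⊢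
  exact hk.mul_continuousOn hu isCompact_Icc

theorem Admissible.sq_div_add_integrable {a b : ℝ} {p Q : ℝ → ℂ} (h : Admissible a b p Q) (μ : ℂ) :
    IntegrableOn (fun t => Q t ^ 2 / p t + μ) (Ioo a b) :=
  h.sq_div_integrable.add (integrableOn_const (by simp))

/-- Solutions of the integrated first order system are in the domain of the maximal operator. Here
`p ≠ 0` almost everywhere is needed to recover `v = p u' - Q u` from `u' = (Q / p) u + (1 / p) v`.
-/
theorem isMaxPair_of_eq_integral {a b : ℝ} (hab : a ≤ b) {p Q : ℝ → ℂ} (h : Admissible a b p Q)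
    {μ : ℂ} {y f : L2 a b} {u v : ℝ → ℂ} (hu : ContinuousOn u (Icc a b))
    (hv : ContinuousOn v (Icc a b)) (hy : y =ᵐ[volume.restrict (Ioo a b)] u)
    (eu : ∀ t ∈ Icc a b, u t = u a + ∫ x in a..t, (Q x / p x * u x + 1 / p x * v x))
    (ev : ∀ t ∈ Icc a b, v t = v a +
      ∫ x in a..t, (-((Q x ^ 2 / p x + μ) * u x) - Q x / p x * v x - f x)) :
    IsMaxPair a b p Q y (f + μ • y) u v := by
  have iu : IntegrableOn (fun x => Q x / p x * u x + 1 / p x * v x) (Ioo a b) :=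
    (integrableOn_mul_of_continuousOn h.div_integrable hu).add
      (integrableOn_mul_of_continuousOn h.inv_integrable hv)
  have iv : IntegrableOn
      (fun x => -((Q x ^ 2 / p x + μ) * u x) - Q x / p x * v x - f x) (Ioo a b) :=
    ((integrableOn_mul_of_continuousOn (h.sq_div_add_integrable μ) hu).neg.sub
      (integrableOn_mul_of_continuousOn h.div_integrable hv)).sub (integrableOn_L2 f)
  refine ⟨absolutelyContinuousOnInterval_of_eq_add_integral hab iu eu,
    absolutelyContinuousOnInterval_of_eq_add_integral hab iv ev, hy, ?_, ?_⟩
  · filter_upwards [ae_deriv_eq_of_eq_add_integral hab iu eu, h.ne_zero] with t h1 h2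
    rw [quasiDeriv, h1]
    field_simp
    ring
  · filter_upwards [ae_deriv_eq_of_eq_add_integral hab iv ev, Lp.coeFn_add f (μ • y),
      Lp.coeFn_smul μ y, hy] with t h1 h2 h3 h4
    rw [h2, Pi.add_apply, h3, Pi.smul_apply, h4, quasiDeriv2, h1, smul_eq_mul]
    ring

theorem IsMaxPair.eq_integral {a b : ℝ} (hab : a ≤ b) {p Q : ℝ → ℂ} (h : Admissible a b p Q)
    {μ : ℂ} {y f : L2 a b} {u v : ℝ → ℂ} (H : IsMaxPair a b p Q y (f + μ • y) u v) :
    (∀ t ∈ Icc a b, u t = u a + ∫ x in a..t, (Q x / p x * u x + 1 / p x * v x)) ∧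
    ∀ t ∈ Icc a b, v t = v a +
      ∫ x in a..t, (-((Q x ^ 2 / p x + μ) * u x) - Q x / p x * v x - f x) := by
  have hu : ContinuousOn u (Icc a b) := uIcc_of_le hab ▸ H.ac_zero.continuousOn
  have hv : ContinuousOn v (Icc a b) := uIcc_of_le hab ▸ H.ac_one.continuousOn
  refine ⟨fun t ht => eq_add_integral_of_deriv_ae_eq hab H.ac_zero
      ((integrableOn_mul_of_continuousOn h.div_integrable hu).add
        (integrableOn_mul_of_continuousOn h.inv_integrable hv)) ?_ ht,
    fun t ht => eq_add_integral_of_deriv_ae_eq hab H.ac_one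
      (((integrableOn_mul_of_continuousOn (h.sq_div_add_integrable μ) hu).neg.sub
        (integrableOn_mul_of_continuousOn h.div_integrable hv)).sub (integrableOn_L2 f)) ?_ ht⟩
  · filter_upwards [H.rep_one, h.ne_zero] with t h1 h2
    simp only [Pi.add_apply]
    rw [h1, quasiDeriv]
    field_simp
    ring
  · filter_upwards [H.rep_two, Lp.coeFn_add f (μ • y), Lp.coeFn_smul μ y, H.rep_zero]
      with t h1 h2 h3 h4
    rw [h2, Pi.add_apply, h3, Pi.smul_apply, h4, quasiDeriv2, smul_eq_mul] at h1
    simp only [Pi.sub_apply, Pi.neg_apply]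
    linear_combination h1

/-! ### The resolvent -/

/-- The operator `1 - K` whose invertibility decides whether `μ` is in the resolvent set. -/
def charOp {a b : ℝ} (hab : a ≤ b) (p Q : ℝ → ℂ) (α β : Matrix (Fin 2) (Fin 2) ℂ) (μ : ℂ) :
    (Icc a b →ᵇ ℂ) × (Icc a b →ᵇ ℂ) →L[ℂ] (Icc a b →ᵇ ℂ) × (Icc a b →ᵇ ℂ) :=
  1 - bvpOp hab α β (fun t => 1 / p t) (fun t => Q t / p t) (fun t => Q t ^ 2 / p t + μ)

/-- Every solution `w` of `charOp w = (0, -∫ₐ f)` gives a solution of `(L - μ) y = f`. -/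
theorem mem_boundaryGraph_of_charOp_apply_eq {a b : ℝ} (hab : a ≤ b) {p Q : ℝ → ℂ}
    (h : Admissible a b p Q) {α β : Matrix (Fin 2) (Fin 2) ℂ} {μ : ℂ} {f : L2 a b}
    {w : (Icc a b →ᵇ ℂ) × (Icc a b →ᵇ ℂ)}
    (hw : charOp hab p Q α β μ w = (0, -primitiveL2 hab f)) :
    IsMaxPair a b p Q (toL2 hab w.1) (f + μ • toL2 hab w.1) (IccExtend hab w.1)
      (IccExtend hab w.2) ∧
    (toL2 hab w.1, f + μ • toL2 hab w.1) ∈ boundaryGraph a b p Q α β := by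
  obtain ⟨hb, eu, ev⟩ := (one_sub_bvpOp_apply_eq_iff hab α β h.inv_integrable h.div_integrable
    (h.sq_div_add_integrable μ) f w).1 hw
  have hm := isMaxPair_of_eq_integral hab h (continuous_IccExtend hab w.1).continuousOn
    (continuous_IccExtend hab w.2).continuousOn (coeFn_toL2 hab w.1) eu ev
  exact ⟨hm, _, _, hm, hb⟩

/-- Every solution of `(L - μ) y = f` comes from a solution of `charOp w = (0, -∫ₐ f)`, namely the
pair of the continuous representatives of `y` and its quasi-derivative. -/
theorem exists_charOp_apply_eq {a b : ℝ} (hab : a ≤ b) {p Q : ℝ → ℂ}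
    (h : Admissible a b p Q) {α β : Matrix (Fin 2) (Fin 2) ℂ} {μ : ℂ} {y f : L2 a b}
    (hy : (y, f + μ • y) ∈ boundaryGraph a b p Q α β) :
    ∃ w, charOp hab p Q α β μ w = (0, -primitiveL2 hab f) ∧ toL2 hab w.1 = y := by
  obtain ⟨u, v, H, hb⟩ := hy
  have hu : ContinuousOn u (Icc a b) := uIcc_of_le hab ▸ H.ac_zero.continuousOn
  have hv : ContinuousOn v (Icc a b) := uIcc_of_le hab ▸ H.ac_one.continuousOn
  let U : Icc a b →ᵇ ℂ := .mkOfCompact ⟨_, hu.domRestrict⟩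
  let V : Icc a b →ᵇ ℂ := .mkOfCompact ⟨_, hv.domRestrict⟩
  have eU : ∀ t ∈ Icc a b, IccExtend hab U t = u t := fun t ht => IccExtend_of_mem hab U ht
  have eV : ∀ t ∈ Icc a b, IccExtend hab V t = v t := fun t ht => IccExtend_of_mem hab V ht
  have ha : a ∈ Icc a b := left_mem_Icc.2 hab
  have hb' : b ∈ Icc a b := right_mem_Icc.2 hab
  obtain ⟨iu, iv⟩ := H.eq_integral hab h
  have hsub : ∀ t ∈ Icc a b, uIcc a t ⊆ Icc a b := fun t ht => uIcc_subset_Icc ha ht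
  refine ⟨(U, V), (one_sub_bvpOp_apply_eq_iff hab α β h.inv_integrable h.div_integrable
    (h.sq_div_add_integrable μ) f (U, V)).2 ⟨?_, fun t ht => ?_, fun t ht => ?_⟩, ?_⟩
  · rw [eU a ha, eV a ha, eU b hb', eV b hb', hb]
  · rw [eU t ht, eU a ha, iu t ht]
    congr 1
    exact intervalIntegral.integral_congr fun x hx => by
      simp only [eU x (hsub t ht hx), eV x (hsub t ht hx)]
  · rw [eV t ht, eV a ha, iv t ht]
    congr 1
    exact intervalIntegral.integral_congr fun x hx => by
      simp only [eU x (hsub t ht hx), eV x (hsub t ht hx)]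
  · refine Lp.ext ?_
    filter_upwards [coeFn_toL2 hab U, H.rep_zero, ae_restrict_mem measurableSet_Ioo]
      with t h1 h2 ht
    rw [h2, ← eU t (Ioo_subset_Icc_self ht)]
    exact h1

/-- The operator in `L₂` taking `f` to the first component of `G (0, -∫ₐ f)`. For `G` the inverse
of `charOp`, this is the resolvent. -/
def solutionOp {a b : ℝ} (hab : a ≤ b)
    (G : (Icc a b →ᵇ ℂ) × (Icc a b →ᵇ ℂ) →L[ℂ] (Icc a b →ᵇ ℂ) × (Icc a b →ᵇ ℂ)) :
    L2 a b →L[ℂ] L2 a b :=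
  (toL2 hab ∘L .fst ℂ _ _) ∘L G ∘L (.inr ℂ _ _ ∘L (-primitiveL2 hab))

theorem solutionOp_apply {a b : ℝ} (hab : a ≤ b)
    (G : (Icc a b →ᵇ ℂ) × (Icc a b →ᵇ ℂ) →L[ℂ] (Icc a b →ᵇ ℂ) × (Icc a b →ᵇ ℂ)) (f : L2 a b) :
    solutionOp hab G f = toL2 hab (G (0, -primitiveL2 hab f)).1 := rfl

theorem isResolventAt_solutionOp {a b : ℝ} (hab : a ≤ b) {p Q : ℝ → ℂ}
    (h : Admissible a b p Q) {α β : Matrix (Fin 2) (Fin 2) ℂ} {μ : ℂ}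
    (hU : IsUnit (charOp hab p Q α β μ)) :
    IsResolventAt (boundaryOperator a b p Q α β) μ
      (solutionOp hab (Ring.inverse (charOp hab p Q α β μ))) := by
  set S := charOp hab p Q α β μ with hS
  have hl (w) : Ring.inverse S (S w) = w :=
    DFunLike.congr_fun (Ring.inverse_mul_cancel S hU) w
  have hr (w) : S (Ring.inverse S w) = w :=
    DFunLike.congr_fun (Ring.mul_inverse_cancel S hU) w
  constructor
  · intro f
    have hg := (mem_boundaryGraph_of_charOp_apply_eq hab h (hr (0, -primitiveL2 hab f))).2
    rw [← solutionOp_apply, ← graph_boundaryOperator, LinearPMap.mem_graph_iff] at hg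
    obtain ⟨y, hy₁, hy₂⟩ := hg
    simp only at hy₁ hy₂
    refine ⟨hy₁ ▸ y.2, ?_⟩
    have e : (⟨_, hy₁ ▸ y.2⟩ : (boundaryOperator a b p Q α β).domain) = y :=
      Subtype.ext hy₁.symm
    rw [e, hy₂, add_sub_cancel_right]
  · intro y
    have hg := LinearPMap.mem_graph (boundaryOperator a b p Q α β) y
    rw [graph_boundaryOperator,
      ← sub_add_cancel (boundaryOperator a b p Q α β y) (μ • (y : L2 a b))] at hg
    obtain ⟨w, hw, hwy⟩ := exists_charOp_apply_eq hab h hg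
    rw [solutionOp_apply, ← hw, ← hS, hl, hwy]

/-- If `μ` is in the resolvent set, then `charOp` is injective: an element of its kernel is a
solution of `(L - μ) y = 0` together with its quasi-derivative. As `charOp` is a compact
perturbation of the identity, it is invertible by the Fredholm alternative. -/
theorem isUnit_charOp {a b : ℝ} (hab : a < b) {p Q : ℝ → ℂ}
    (h : Admissible a b p Q) {α β : Matrix (Fin 2) (Fin 2) ℂ} {μ : ℂ}
    (hμ : μ ∈ resolventSet (boundaryOperator a b p Q α β)) :
    IsUnit (charOp hab.le p Q α β μ) := by
  obtain ⟨R, hR⟩ := hμ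
  have hK := isCompactOperator_bvpOp hab.le α β h.inv_integrable h.div_integrable
    (h.sq_div_add_integrable μ)
  have hinj (w) (hw : charOp hab.le p Q α β μ w = 0) : w = 0 := by
    obtain ⟨H, hg⟩ := mem_boundaryGraph_of_charOp_apply_eq hab.le h (f := 0) (w := w)
      (by rw [hw, map_zero, neg_zero]; rfl)
    rw [zero_add] at hg
    rw [← graph_boundaryOperator, LinearPMap.mem_graph_iff] at hg
    obtain ⟨y, hy₁, hy₂⟩ := hg
    simp only at hy₁ hy₂
    have h0 : toL2 hab.le w.1 = 0 := by
      have := hR.2 y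
      rwa [hy₂, hy₁, sub_self, map_zero, eq_comm] at this
    have hu := eqOn_zero_of_ae H.ac_zero
      (H.rep_zero.symm.trans (by rw [h0]; exact Lp.coeFn_zero _ _ _))
    have hv := eqOn_zero_of_ae H.ac_one (by
      filter_upwards [H.rep_one, ae_restrict_mem measurableSet_Ioo] with t h1 ht
      simp [h1, quasiDeriv, hu t ht])
    have hz (z : Icc a b →ᵇ ℂ) (hz : ∀ t ∈ Ioo a b, IccExtend hab.le z t = 0) : z = 0 := by
      ext t
      have hcl : EqOn (IccExtend hab.le z) 0 (closure (Ioo a b)) :=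
        EqOn.closure hz (continuous_IccExtend hab.le z) continuous_const
      rw [closure_Ioo hab.ne] at hcl
      exact (IccExtend_val hab.le z t).symm.trans (hcl t.2)
    exact Prod.ext (hz _ fun t ht => (hu t ht).1) (hz _ fun t ht => (hv t ht).1)
  rcases hK.hasEigenvalue_or_mem_resolventSet one_ne_zero with he | he
  · obtain ⟨w, hw⟩ := he.exists_hasEigenvector
    refine absurd (hinj w ?_) hw.2
    have := hw.apply_eq_smul
    rw [one_smul] at this
    exact sub_eq_zero.2 this.symm
  · rw [spectrum.mem_resolventSet_iff, map_one] at he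
    exact he

/-- Invertibility of `1 - K` is stable under small perturbations of `K`, and the inverse depends
continuously on `K`. -/
theorem tendsto_inverse_one_sub {E : Type*} [NormedAddCommGroup E] [NormedSpace ℂ E]
    [CompleteSpace E] {ι : Type*} {F : Filter ι} {K : ι → E →L[ℂ] E} {K₀ : E →L[ℂ] E}
    (hK : Tendsto K F (𝓝 K₀)) (hU : IsUnit (1 - K₀)) :
    (∀ᶠ i in F, IsUnit (1 - K i)) ∧
      Tendsto (fun i => Ring.inverse (1 - K i)) F (𝓝 (Ring.inverse (1 - K₀))) := by
  have hS := hK.const_sub 1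
  obtain ⟨S, hSU⟩ := hU
  rw [← hSU] at hS ⊢
  exact ⟨hS.eventually S.nhds, (NormedRing.inverse_continuousAt S).tendsto.comp hS⟩

theorem tendsto_inverse_charOp {a b : ℝ} (hab : a ≤ b) {ι : Type*} {F : Filter ι}
    {p Q : ι → ℝ → ℂ} {p₀ Q₀ : ℝ → ℂ} {α β : ι → Matrix (Fin 2) (Fin 2) ℂ}
    {α₀ β₀ : Matrix (Fin 2) (Fin 2) ℂ} (μ : ℂ) (h : ∀ᶠ i in F, Admissible a b (p i) (Q i))
    (h₀ : Admissible a b p₀ Q₀)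
    (h₁ : Tendsto (fun i => ∫ t in Ioo a b, ‖1 / p i t - 1 / p₀ t‖) F (𝓝 0))
    (h₂ : Tendsto (fun i => ∫ t in Ioo a b, ‖Q i t / p i t - Q₀ t / p₀ t‖) F (𝓝 0))
    (h₃ : Tendsto (fun i => ∫ t in Ioo a b, ‖Q i t ^ 2 / p i t - Q₀ t ^ 2 / p₀ t‖) F (𝓝 0))
    (hα : Tendsto α F (𝓝 α₀)) (hβ : Tendsto β F (𝓝 β₀))
    (hU : IsUnit (charOp hab p₀ Q₀ α₀ β₀ μ)) :
    (∀ᶠ i in F, IsUnit (charOp hab (p i) (Q i) (α i) (β i) μ)) ∧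
      Tendsto (fun i => Ring.inverse (charOp hab (p i) (Q i) (α i) (β i) μ)) F
        (𝓝 (Ring.inverse (charOp hab p₀ Q₀ α₀ β₀ μ))) :=
  tendsto_inverse_one_sub (tendsto_bvpOp hab hα hβ
    (tendsto_volterra hab (h.mono fun _ hi => hi.inv_integrable) h₀.inv_integrable h₁)
    (tendsto_volterra hab (h.mono fun _ hi => hi.div_integrable) h₀.div_integrable h₂)
    (tendsto_volterra hab (h.mono fun _ hi => hi.sq_div_add_integrable μ)
      (h₀.sq_div_add_integrable μ) (by simpa only [add_sub_add_right_eq_sub] using h₃))) hU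

theorem tendsto_clm_comp_comp {X Y Z : Type*} [NormedAddCommGroup X] [NormedSpace ℂ X]
    [NormedAddCommGroup Y] [NormedSpace ℂ Y] [NormedAddCommGroup Z] [NormedSpace ℂ Z]
    {ι : Type*} {F : Filter ι} {K : ι → Y →L[ℂ] Y} {K₀ : Y →L[ℂ] Y}
    (hK : Tendsto K F (𝓝 K₀)) (A : Y →L[ℂ] Z) (B : X →L[ℂ] Y) :
    Tendsto (fun i => A ∘L K i ∘L B) F (𝓝 (A ∘L K₀ ∘L B)) := by
  have h : Continuous fun T : Y →L[ℂ] Y => A ∘L T ∘L B :=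
    (continuous_id.clm_comp_const B).const_clm_comp A
  exact (h.tendsto K₀).comp hK

theorem tendsto_solutionOp {a b : ℝ} (hab : a ≤ b) {ι : Type*} {F : Filter ι}
    {G : ι → (Icc a b →ᵇ ℂ) × (Icc a b →ᵇ ℂ) →L[ℂ] (Icc a b →ᵇ ℂ) × (Icc a b →ᵇ ℂ)}
    {G₀ : (Icc a b →ᵇ ℂ) × (Icc a b →ᵇ ℂ) →L[ℂ] (Icc a b →ᵇ ℂ) × (Icc a b →ᵇ ℂ)}
    (h : Tendsto G F (𝓝 G₀)) :
    Tendsto (fun i => solutionOp hab (G i)) F (𝓝 (solutionOp hab G₀)) :=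
  tendsto_clm_comp_comp h _ _

end SturmLiouville

end

theorem mainTheorem1 (a b : ℝ) (hab : a < b) (ε₀ : ℝ) (hε₀ : 0 < ε₀)
    (p Q : ℝ → ℝ → ℂ) (α β : ℝ → Matrix (Fin 2) (Fin 2) ℂ)
    (hadm : ∀ ε ∈ Set.Icc 0 ε₀, SturmLiouville.Admissible a b (p ε) (Q ε))
    (hρ : (SturmLiouville.resolventSet
      (SturmLiouville.boundaryOperator a b (p 0) (Q 0) (α 0) (β 0))).Nonempty)
    (h₁ : Tendsto (fun ε => ∫ t in Set.Ioo a b, ‖1 / p ε t - 1 / p 0 t‖) (𝓝[>] 0) (𝓝 0))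
    (h₂ : Tendsto (fun ε => ∫ t in Set.Ioo a b, ‖Q ε t / p ε t - Q 0 t / p 0 t‖)
      (𝓝[>] 0) (𝓝 0))
    (h₃ : Tendsto (fun ε => ∫ t in Set.Ioo a b, ‖Q ε t ^ 2 / p ε t - Q 0 t ^ 2 / p 0 t‖)
      (𝓝[>] 0) (𝓝 0))
    (hα : Tendsto α (𝓝[>] 0) (𝓝 (α 0)))
    (hβ : Tendsto β (𝓝[>] 0) (𝓝 (β 0))) :
    SturmLiouville.NormResolventConverges
      (fun ε => SturmLiouville.boundaryOperator a b (p ε) (Q ε) (α ε) (β ε)) := by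
  obtain ⟨μ, hμ⟩ := hρ
  have h₀ := hadm 0 ⟨le_rfl, hε₀.le⟩
  have hε : ∀ᶠ ε in 𝓝[>] (0 : ℝ), SturmLiouville.Admissible a b (p ε) (Q ε) := by
    filter_upwards [Ioc_mem_nhdsGT hε₀] with ε hε using hadm ε (Ioc_subset_Icc_self hε)
  have hU := SturmLiouville.isUnit_charOp hab h₀ hμ
  obtain ⟨hUε, hinv⟩ :=
    SturmLiouville.tendsto_inverse_charOp hab.le μ hε h₀ h₁ h₂ h₃ hα hβ hU
  have hR₀ := SturmLiouville.isResolventAt_solutionOp hab.le h₀ hU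
  have hR : ∀ᶠ ε in 𝓝[>] (0 : ℝ), SturmLiouville.IsResolventAt
      (SturmLiouville.boundaryOperator a b (p ε) (Q ε) (α ε) (β ε)) μ
      (SturmLiouville.solutionOp hab.le
        (Ring.inverse (SturmLiouville.charOp hab.le (p ε) (Q ε) (α ε) (β ε) μ))) := by
    filter_upwards [hε, hUε] with ε h1 h2 using
      SturmLiouville.isResolventAt_solutionOp hab.le h1 h2
  refine ⟨μ, hμ, hR.mono fun ε h => ⟨_, h⟩, ?_⟩
  have hlim := SturmLiouville.tendsto_solutionOp hab.le hinv
  refine (tendsto_iff_norm_sub_tendsto_zero.1 hlim).congr' ?_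
  filter_upwards [hR] with ε h
  rw [h.resolvent_eq, hR₀.resolvent_eq]
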